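/- Let $(R,\mathfrak m)$ be a Noetherian local ring with residue field $k=R/\mathfrak m$. For a nonzero finitely generated $R$-module $N$, the depth $\operatorname{depth}_R(N)$ is the supremum of the lengths of the $N$-regular sequences contained in $\mathfrak m$, and the type of $N$ is $$\mathrm r_R(N)=\dim_{k}\operatorname{Ext}_R^{t}(k,N),\qquad t=\operatorname{depth}_R(N);$$ write $\mathrm r(R)=\mathrm r_R(R)$, and similarly for other local rings. The ring $R$ is Cohen–Macaulay if $\operatorname{depth}_R(R)=\dim R$, and a nonzero finitely generated $R$-module $N$ is maximal Cohen–Macaulay if $\operatorname{depth}_R(N)=\dim R$. A parameter ideal of $R$ is an $\mathfrak m$-primary ideal that can be generated by $\dim R$ elements. For an $R$-module $M$, the idealization $R\ltimes M$ is the commutative ring $R\times M$ with componentwise addition and multiplication $(a,x)(b,y)=(ab,ay+bx)$; it is local with maximal ideal $\mathfrak m\times M$. **Corollary.** Assume that $R$ is Cohen–Macaulay and let $M$ be a (nonzero, finitely generated) maximal Cohen–Macaulay $R$-module. Then $$\mathrm r_R(M)\le \mathrm r(R\ltimes M)\le \mathrm r(R)+\mathrm r_R(M).$$ Moreover, for every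 parameter ideal $Q$ of $R$: (i) $\mathrm r(R\ltimes M)=\mathrm r_R(M)$ if and only if $M/QM$ is a faithful $R/Q$-module; (ii) $\mathrm r(R\ltimes M)=\mathrm r(R)+\mathrm r_R(M)$ if and only if $(Q:_R\mathfrak m)M=QM$, where $Q:_R\mathfrak m=\{a\in R : a\mathfrak m\subseteq Q\}$. -/

import Mathlib

open CategoryTheory CategoryTheory.Abelian IsLocalRing

universe u

namespace LocalAlgebra

section Depth

variable (R : Type u) [CommRing R] [IsLocalRing R] (M : Type u) [AddCommGroup M] [Module R M]

/-- The depth of a nonzero finitely generated module `M` over a Noetherian local ring `R`: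
the supremum of the lengths of the `M`-regular sequences contained in the maximal ideal.
(It is only used for nonzero modules.) -/
noncomputable def depth : ℕ∞ :=
  ⨆ (rs : List R) (_ : (∀ r ∈ rs, r ∈ maximalIdeal R) ∧ RingTheory.Sequence.IsRegular M rs),
    (rs.length : ℕ∞)

/-- The local ring `R` is Cohen–Macaulay: `depth R = dim R`. -/
def IsCohenMacaulayRing : Prop :=
  (depth R R : WithBot ℕ∞) = ringKrullDim R

/-- The finitely generated module `M` is maximal Cohen–Macaulay: it is nonzero and
`depth M = dim R`. -/
structure IsMaximalCohenMacaulay : Prop where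
  nontrivial : Nontrivial M
  depth_eq : (depth R M : WithBot ℕ∞) = ringKrullDim R

end Depth

section CMType

variable (R : Type u) [CommRing R] [IsLocalRing R]

/-- `Ext^n_R(k, X)` is annihilated by the maximal ideal of `R`, where `k` is the residue field. -/
theorem isTorsionBySet_ext (X : ModuleCat.{u} R) (n : ℕ) :
    Module.IsTorsionBySet R (Ext (ModuleCat.of R (ResidueField R)) X n)
      (maximalIdeal R : Set R) := by
  rintro e ⟨a, ha⟩
  have h0 : a • 𝟙 (ModuleCat.of R (ResidueField R)) = 0 := by
    ext x
    change a • x = 0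
    rw [Algebra.smul_def, ResidueField.algebraMap_eq, (residue_eq_zero_iff a).2 ha, zero_mul]
  have h1 : a • e = (Ext.mk₀ (a • 𝟙 (ModuleCat.of R (ResidueField R)))).comp e (zero_add n) := by
    simp [Ext.mk₀_smul]
  change a • e = 0
  rw [h1, h0]
  simp

/-- The vector space structure over the residue field `k` on `Ext^n_R(k, X)`, induced from its
`R`-module structure. -/
noncomputable instance residueFieldModuleExt (X : ModuleCat.{u} R) (n : ℕ) :
    Module (ResidueField R) (Ext (ModuleCat.of R (ResidueField R)) X n) :=
  (isTorsionBySet_ext R X n).module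

/-- The (Cohen–Macaulay) type `r_R(M) = dim_k Ext_R^t(k, M)`, with `k` the residue field of `R`
and `t = depth M`. The Cohen–Macaulay type of the ring `R` is `cmType R R`. -/
noncomputable def cmType (M : Type u) [AddCommGroup M] [Module R M] : ℕ :=
  Module.finrank (ResidueField R)
    (Ext (ModuleCat.of R (ResidueField R)) (ModuleCat.of R M) (depth R M).toNat)

variable {R} in
/-- A parameter ideal of `R`: an ideal generated by `dim R` elements which is primary to the
maximal ideal (that is, whose radical is the maximal ideal). -/
def IsParameterIdeal (Q : Ideal R) : Prop :=
  ∃ (d : ℕ) (x : Fin d → R), (d : WithBot ℕ∞) = ringKrullDim R ∧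
    Q = Ideal.span (Set.range x) ∧ Q.radical = maximalIdeal R

end CMType

/-- The idealization `R ⋉ M` of a module over a local ring is a local ring. -/
instance isLocalRing_idealization (R : Type u) [CommRing R] [IsLocalRing R] (M : Type u)
    [AddCommGroup M] [Module R M] [Module Rᵐᵒᵖ M] [IsCentralScalar R M] :
    IsLocalRing (TrivSqZeroExt R M) := by
  refine .of_isUnit_or_isUnit_one_sub_self fun a => ?_
  simp only [TrivSqZeroExt.isUnit_iff_isUnit_fst, TrivSqZeroExt.fst_sub, TrivSqZeroExt.fst_one]
  exact IsLocalRing.isUnit_or_isUnit_one_sub_self a.fst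

end LocalAlgebra

namespace LocalAlgebra

open RingTheory.Sequence Pointwise

/-! Let `Q` be generated by parameters `rs` of length `d = dim R`, and put `A = R ⋉ M`. Then `rs` is
regular on `R`, on `M`, and hence on `A`, so each type is the length of the socle of the reduction
modulo `Q` (`cmType_eq_length`). Since `A/QA = (R/Q) ⋉ (M/QM)`, its socle is the product of
`Soc(R/Q) ∩ Ann(M/QM)` and `Soc(M/QM)`. Thus `r(A) = s + r(M)`, where `s` is the length of `Soc(R/Q)
∩ Ann(M/QM)` (`cmType_trivSqZeroExt`). Clearly `0 ≤ s ≤ r(R)`. As `R/Q` is Artinian, `s = 0` iff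
`Ann(M/QM)` is zero in `R/Q`; and `s = r(R)` iff `Soc(R/Q) = (Q : m)/Q` kills `M/QM`. Depth only
provides some regular sequence of length `d`, whereas `Q` is arbitrary. Regularity of `rs` is
therefore derived from `ExtVanishing`, a form of `depth ≥ d` that names no sequence and passes
through short exact sequences. -/

/-- `Ext^i(N, M)` vanishes for `i < d` and all finite modules `N` supported at the ideal `I`. -/
def ExtVanishing {R : Type u} [CommRing R] (I : Ideal R) (M : Type u) [AddCommGroup M] [Module R M]
    (d : ℕ) : Prop :=
  ∀ (N : Type u) [AddCommGroup N] [Module R N] [Module.Finite R N],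
    I ≤ (Module.annihilator R N).radical → ∀ i < d,
      Subsingleton (Ext (ModuleCat.of R N) (ModuleCat.of R M) i)

/-! ### Depth, vanishing of Ext, and regularity of systems of parameters. -/

section Noetherian

variable {R : Type u} [CommRing R] [IsLocalRing R] [IsNoetherianRing R]
  {M : Type u} [AddCommGroup M] [Module R M] [Module.Finite R M]

omit [IsNoetherianRing R] in
theorem maximalIdeal_smul_top_lt [Nontrivial M] :
    maximalIdeal R • (⊤ : Submodule R M) < ⊤ := by
  refine lt_top_iff_ne_top.2 fun h => ?_
  exact (top_ne_bot : (⊤ : Submodule R M) ≠ ⊥) (Submodule.eq_bot_of_le_smul_of_le_jacobson_bot _ _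
    Module.Finite.fg_top h.ge (maximalIdeal_le_jacobson _))

theorem subsingleton_ext_of_isRegular [Nontrivial M] {rs : List R}
    (hrs : ∀ r ∈ rs, r ∈ maximalIdeal R) (hreg : IsRegular M rs) :
    ExtVanishing (maximalIdeal R) M rs.length := by
  intro N _ _ _ hN i hi
  refine ModuleCat.subsingleton_ext_of_exists_isRegular (maximalIdeal R) (ModuleCat.of R N) ?_
    (ModuleCat.of R M) maximalIdeal_smul_top_lt rs hrs hreg i hi
  rw [Module.support_eq_zeroLocus, PrimeSpectrum.zeroLocus_subset_zeroLocus_iff]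
  exact hN

/-- For each `i < d` some regular sequence is longer than `i`, so the supremum need not be known to
be attained. -/
theorem extVanishing_of_le_depth [Nontrivial M] {d : ℕ} (h : (d : ℕ∞) ≤ depth R M) :
    ExtVanishing (maximalIdeal R) M d := by
  intro N _ _ _ hN i hi
  have h1 : (i : ℕ∞) < depth R M := lt_of_lt_of_le (by exact_mod_cast hi) h
  simp only [depth, lt_iSup_iff] at h1
  obtain ⟨rs, ⟨hrs, hreg⟩, hlt⟩ := h1
  exact subsingleton_ext_of_isRegular hrs hreg N hN i (by exact_mod_cast hlt)

/-- Ischebeck's vanishing, in terms of systems of parameters. -/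
theorem subsingleton_ext_of_le_radical {d : ℕ} (h : ExtVanishing (maximalIdeal R) M d)
    (ys : List R) (hys : ∀ y ∈ ys, y ∈ maximalIdeal R)
    (N : Type u) [AddCommGroup N] [Module R N] [Module.Finite R N]
    (hN : maximalIdeal R ≤ (Ideal.ofList ys ⊔ Module.annihilator R N).radical)
    (i : ℕ) (hi : i + ys.length < d) :
    Subsingleton (Ext (ModuleCat.of R N) (ModuleCat.of R M) i) := by
  induction ys generalizing N i with
  | nil => exact h N (by simpa using hN) i (by simpa using hi)
  | cons y ys ih =>
    simp only [List.mem_cons, forall_eq_or_imp, List.length_cons] at hys hi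
    have key (N' : Type u) [AddCommGroup N'] [Module R N'] [Module.Finite R N']
        (h1 : y ∈ Module.annihilator R N')
        (h2 : Module.annihilator R N ≤ Module.annihilator R N') (j : ℕ)
        (hj : j + ys.length < d) :
        Subsingleton (Ext (ModuleCat.of R N') (ModuleCat.of R M) j) := by
      refine ih hys.2 N' (hN.trans (Ideal.radical_mono ?_)) j hj
      rw [Ideal.ofList_cons]
      refine sup_le (sup_le ?_ le_sup_left) (h2.trans le_sup_right)
      exact ((Ideal.span_singleton_le_iff_mem _).2 h1).trans le_sup_right
    -- Multiplication by `y` factors as `N ↠ yN ↪ N`, with kernel and cokernel killed by `y`, so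
    -- both fall under the induction on `ys`. Vanishing of `Ext^i` of the kernel and `Ext^(i+1)` of
    -- the cokernel makes `y` surjective on `Ext^i(N, M)`; Nakayama concludes. The shorter list pays
    -- for the degree `i + 1`.
    let f : N →ₗ[R] N := LinearMap.lsmul R N y
    have hS₁ : f.rangeRestrict.shortComplexKer.ShortExact :=
      LinearMap.shortExact_shortComplexKer f.surjective_rangeRestrict
    have hS₂ : (ModuleCat.shortComplexOfCompEqZero (LinearMap.range f).subtype
        (LinearMap.range f).mkQ (LinearMap.exact_subtype_mkQ _).linearMap_comp_eq_zero).ShortExact :=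
      ModuleCat.shortComplex_shortExact _ (LinearMap.exact_subtype_mkQ _)
        (Submodule.subtype_injective _) (Submodule.mkQ_surjective _)
    have hker := key (LinearMap.ker f.rangeRestrict)
      (Module.mem_annihilator.2 fun x => Subtype.ext (by
        simpa [Subtype.ext_iff, f] using x.2))
      (LinearMap.annihilator_le_of_injective _ (Submodule.subtype_injective _)) i (by omega)
    have hcoker := key (N ⧸ LinearMap.range f)
      (Module.mem_annihilator.2 fun x => by
        obtain ⟨x, rfl⟩ := Submodule.mkQ_surjective _ x
        rw [← map_smul]
        exact (Submodule.Quotient.mk_eq_zero _).2 ⟨x, rfl⟩)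
      (LinearMap.annihilator_le_of_surjective _ (Submodule.mkQ_surjective _)) (1 + i) (by omega)
    have hdiv (e : Ext (ModuleCat.of R N) (ModuleCat.of R M) i) :
        ∃ e' : Ext (ModuleCat.of R N) (ModuleCat.of R M) i, y • e' = e := by
      obtain ⟨e₁, rfl⟩ := Ext.contravariant_sequence_exact₂ hS₁ _ e (hker.elim _ _)
      obtain ⟨e₂, rfl⟩ := Ext.contravariant_sequence_exact₁ hS₂ _ e₁ rfl (hcoker.elim _ _)
      refine ⟨e₂, ?_⟩
      have : y • e₂ = (Ext.mk₀ (y • 𝟙 (ModuleCat.of R N))).comp e₂ (zero_add i) := by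
        simp [Ext.mk₀_smul]
      rw [this, Ext.mk₀_comp_mk₀_assoc]
      rfl
    have hbot : (⊤ : Submodule R (Ext (ModuleCat.of R N) (ModuleCat.of R M) i)) = ⊥ := by
      refine Submodule.eq_bot_of_le_smul_of_le_jacobson_bot _ _
        Module.Finite.fg_top (fun e _ => ?_) (maximalIdeal_le_jacobson _)
      obtain ⟨e', rfl⟩ := hdiv e
      exact Submodule.smul_mem_smul hys.1 trivial
    exact (Submodule.subsingleton_iff R).1 (subsingleton_of_bot_eq_top hbot.symm)

omit [IsLocalRing R] [IsNoetherianRing R] [Module.Finite R M] in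
theorem ExtVanishing.quotSMulTop {I : Ideal R} {d : ℕ} (h : ExtVanishing I M (d + 1))
    {x : R} (hx : IsSMulRegular M x) : ExtVanishing I (QuotSMulTop x M) d := by
  intro N _ _ _ hN i hi
  refine subsingleton_of_forall_eq 0 fun e => ?_
  have h₁ := h N hN (i + 1) (by omega)
  have h₂ := h N hN i (by omega)
  obtain ⟨e', rfl⟩ := Ext.covariant_sequence_exact₃ (ModuleCat.of R N)
    (IsSMulRegular.smulShortComplex_shortExact (M := ModuleCat.of R M) hx) e rfl (h₁.elim _ _)
  rw [show e' = 0 from h₂.elim _ _, Ext.zero_comp]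
  rfl

omit [IsLocalRing R] [IsNoetherianRing R] [Module.Finite R M] in
theorem ExtVanishing.of_exact {I : Ideal R} {d : ℕ} {M' M'' : Type u} [AddCommGroup M']
    [Module R M'] [AddCommGroup M''] [Module R M''] (f : M' →ₗ[R] M) (g : M →ₗ[R] M'')
    (hf : Function.Injective f) (hg : Function.Surjective g) (hfg : Function.Exact f g)
    (h' : ExtVanishing I M' d) (h'' : ExtVanishing I M'' d) : ExtVanishing I M d := by
  intro N _ _ _ hN i hi
  refine subsingleton_of_forall_eq 0 fun e => ?_
  have hS : (ModuleCat.shortComplexOfCompEqZero f g hfg.linearMap_comp_eq_zero).ShortExact :=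
    ModuleCat.shortComplex_shortExact _ hfg hf hg
  obtain ⟨e', rfl⟩ := Ext.covariant_sequence_exact₂ (ModuleCat.of R N) hS e
    ((h'' N hN i hi).elim _ _)
  rw [show e' = 0 from (h' N hN i hi).elim _ _, Ext.zero_comp]

/-- If the first `d` `Ext` groups vanish, then `d` elements generating an ideal that is primary to
the maximal ideal form a weakly regular sequence. -/
theorem ExtVanishing.isWeaklyRegular {M : Type u} [AddCommGroup M] [Module R M]
    [Module.Finite R M] (rs : List R) (hrs : ∀ r ∈ rs, r ∈ maximalIdeal R)
    (h : ExtVanishing (maximalIdeal R) M rs.length)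
    (hrad : maximalIdeal R ≤ (Ideal.ofList rs ⊔ Module.annihilator R M).radical) :
    IsWeaklyRegular M rs := by
  induction rs generalizing M with
  | nil => exact .nil R M
  | cons x rs ih =>
    simp only [List.mem_cons, forall_eq_or_imp, List.length_cons] at hrs h
    -- An `m` with `x • m = 0` is the image of `1` under a map `R/((x) + Ann M) → M`. The remaining
    -- `rs` are parameters on that cyclic module, so degree `0` of the vanishing leaves only the
    -- zero map.
    have hx : IsSMulRegular M x := by
      have hsub := subsingleton_ext_of_le_radical h rs hrs.2
        (R ⧸ (Ideal.span {x} ⊔ Module.annihilator R M)) (by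
          rw [Ideal.annihilator_quotient]
          refine hrad.trans (Ideal.radical_mono ?_)
          rw [Ideal.ofList_cons, sup_comm (Ideal.span {x}), sup_assoc]) 0 (by omega)
      have hsub' : Subsingleton ((R ⧸ (Ideal.span {x} ⊔ Module.annihilator R M)) →ₗ[R] M) :=
        ((Ext.addEquiv₀ (X := ModuleCat.of R (R ⧸ (Ideal.span {x} ⊔ Module.annihilator R M)))
          (Y := ModuleCat.of R M)).trans ModuleCat.homAddEquiv).symm.subsingleton
      refine (isSMulRegular_iff_right_eq_zero_of_smul).2 fun m hm => ?_
      have hle : Ideal.span {x} ⊔ Module.annihilator R M ≤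
          LinearMap.ker (LinearMap.toSpanSingleton R M m) :=
        sup_le ((Ideal.span_singleton_le_iff_mem _).2 hm)
          fun a ha => Module.mem_annihilator.1 ha m
      exact (one_smul R m).symm.trans (DFunLike.congr_fun (hsub'.elim (Submodule.liftQ _ _ hle) 0)
        (Submodule.Quotient.mk 1))
    refine .cons hx (ih hrs.2 (h.quotSMulTop hx) (hrad.trans (Ideal.radical_mono ?_)))
    rw [Ideal.ofList_cons]
    refine sup_le (sup_le ?_ le_sup_left) (le_sup_of_le_right ?_)
    · exact ((Ideal.span_singleton_le_iff_mem _).2 (QuotSMulTop.mem_annihilator M x)).trans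
        le_sup_right
    · exact LinearMap.annihilator_le_of_surjective _ (Submodule.mkQ_surjective _)

/-! ### The type as the length of a socle. -/

omit [IsNoetherianRing R] [Module.Finite R M] in
theorem annihilator_residueField : Module.annihilator R (ResidueField R) = maximalIdeal R :=
  Ideal.annihilator_quotient

omit [IsNoetherianRing R] [Module.Finite R M] in
/-- Dimension shifting along a regular element of the maximal ideal. -/
theorem exists_ext_quotSMulTop_equiv {x : R} (hx : x ∈ maximalIdeal R) (hreg : IsSMulRegular M x)
    (n : ℕ) (h : Subsingleton (Ext (ModuleCat.of R (ResidueField R)) (ModuleCat.of R M) n)) :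
    Nonempty (Ext (ModuleCat.of R (ResidueField R)) (ModuleCat.of R (QuotSMulTop x M)) n ≃ₗ[R]
      Ext (ModuleCat.of R (ResidueField R)) (ModuleCat.of R M) (n + 1)) := by
  have hS := IsSMulRegular.smulShortComplex_shortExact (M := ModuleCat.of R M) hreg
  let δ : Ext (ModuleCat.of R (ResidueField R)) (ModuleCat.of R (QuotSMulTop x M)) n →ₗ[R]
      Ext (ModuleCat.of R (ResidueField R)) (ModuleCat.of R M) (n + 1) :=
    { toFun := fun e => e.comp hS.extClass rfl
      map_add' := fun _ _ => Ext.add_comp _ _ _ _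
      map_smul' := fun _ _ => Ext.smul_comp _ _ _ _ }
  refine ⟨LinearEquiv.ofBijective δ ⟨?_, fun e => ?_⟩⟩
  · refine (injective_iff_map_eq_zero _).2 fun e he => ?_
    obtain ⟨e', rfl⟩ := Ext.covariant_sequence_exact₃ _ hS e rfl he
    rw [show e' = 0 from h.elim _ _, Ext.zero_comp]
    rfl
  -- Surjectivity of the connecting map: `x` lies in the maximal ideal, so it acts as zero on
  -- `Ext^(n+1)(k, M)`.
  · refine Ext.covariant_sequence_exact₁ _ hS e ?_ rfl
    have h1 : e.comp (Ext.mk₀ (x • 𝟙 (ModuleCat.of R M))) (add_zero (n + 1)) = x • e := by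
      simp [Ext.mk₀_smul]
    exact h1.trans (isTorsionBySet_ext R _ _ (a := ⟨x, hx⟩))

-- Each member of the sequence lowers the degree by one through `exists_ext_quotSMulTop_equiv`,
-- until only `Hom` remains.
omit [IsNoetherianRing R] in
theorem nonempty_ext_equiv_hom {M : Type u} [AddCommGroup M] [Module R M] (rs : List R)
    (hrs : ∀ r ∈ rs, r ∈ maximalIdeal R)
    (h : ExtVanishing (maximalIdeal R) M rs.length) (hreg : IsWeaklyRegular M rs) :
    Nonempty (Ext (ModuleCat.of R (ResidueField R)) (ModuleCat.of R M) rs.length ≃ₗ[R]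
      (ResidueField R →ₗ[R] M ⧸ (Ideal.ofList rs • ⊤ : Submodule R M))) := by
  induction rs generalizing M with
  | nil =>
    refine ⟨(Ext.linearEquiv₀ ≪≫ₗ ModuleCat.homLinearEquiv (S := R)) ≪≫ₗ
      LinearEquiv.congrRight (Submodule.quotEquivOfEqBot _ ?_).symm⟩
    rw [Ideal.ofList_nil, Submodule.bot_smul]
  | cons x rs ih =>
    simp only [List.mem_cons, forall_eq_or_imp, List.length_cons, isWeaklyRegular_cons_iff]
      at hrs h hreg
    obtain ⟨e₁⟩ := exists_ext_quotSMulTop_equiv hrs.1 hreg.1 rs.length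
      (h (ResidueField R) (annihilator_residueField.ge.trans Ideal.le_radical) _ (by omega))
    obtain ⟨e₂⟩ := ih hrs.2 (h.quotSMulTop hreg.1) hreg.2
    exact ⟨e₁.symm ≪≫ₗ e₂ ≪≫ₗ LinearEquiv.congrRight
      (Submodule.quotOfListConsSMulTopEquivQuotSMulTopInner M x rs).symm⟩

omit [IsNoetherianRing R] [Module.Finite R M] in
theorem nonempty_residueField_hom_equiv_torsionBySet :
    Nonempty ((ResidueField R →ₗ[R] M) ≃ₗ[R]
      Submodule.torsionBySet R M (maximalIdeal R : Set R)) := by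
  let f : (ResidueField R →ₗ[R] M) →ₗ[R] Submodule.torsionBySet R M (maximalIdeal R : Set R) :=
    (LinearMap.applyₗ (1 : ResidueField R)).codRestrict _ fun g => by
      rw [Submodule.mem_torsionBySet_iff]
      rintro ⟨a, ha⟩
      change a • g 1 = 0
      rw [← map_smul, Algebra.smul_def, ResidueField.algebraMap_eq, (residue_eq_zero_iff a).2 ha,
        zero_mul, map_zero]
  refine ⟨LinearEquiv.ofBijective f ⟨?_, fun m => ?_⟩⟩
  · refine (injective_iff_map_eq_zero _).2 fun g hg => LinearMap.ext fun a => ?_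
    obtain ⟨a, rfl⟩ := residue_surjective a
    have h1 : g 1 = 0 := congrArg Subtype.val hg
    rw [← ResidueField.algebraMap_eq, Algebra.algebraMap_eq_smul_one, map_smul, h1, smul_zero]
    rfl
  · refine ⟨Submodule.liftQ _ (LinearMap.toSpanSingleton R M m) fun a ha => ?_, ?_⟩
    · exact (Submodule.mem_torsionBySet_iff _ _).1 m.2 ⟨a, ha⟩
    · exact Subtype.ext (one_smul R (m : M))

/-- The type of a module of depth `d` is the length of the socle of its reduction modulo a
regular sequence of length `d`. -/
theorem cmType_eq_length (rs : List R) (hrs : ∀ r ∈ rs, r ∈ maximalIdeal R)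
    (h : ExtVanishing (maximalIdeal R) M rs.length) (hreg : IsWeaklyRegular M rs)
    (hdepth : depth R M = rs.length) :
    (cmType R M : ℕ∞) = Module.length R (Submodule.torsionBySet R
      (M ⧸ (Ideal.ofList rs • ⊤ : Submodule R M)) (maximalIdeal R : Set R)) := by
  obtain ⟨e⟩ := nonempty_ext_equiv_hom rs hrs h hreg
  obtain ⟨e'⟩ := nonempty_residueField_hom_equiv_torsionBySet (R := R)
    (M := M ⧸ (Ideal.ofList rs • ⊤ : Submodule R M))
  rw [cmType, hdepth, ENat.toNat_natCast, ← (e ≪≫ₗ e').length_eq]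
  have : IsScalarTower R (ResidueField R)
      (Ext (ModuleCat.of R (ResidueField R)) (ModuleCat.of R M) rs.length) :=
    (isTorsionBySet_ext R (ModuleCat.of R M) rs.length).isScalarTower
  -- Without finiteness `finrank` would default to `0` and could differ from the length.
  have : Module.Finite (ResidueField R)
      (Ext (ModuleCat.of R (ResidueField R)) (ModuleCat.of R M) rs.length) :=
    .of_restrictScalars_finite R _ _
  rw [← Module.length_eq_finrank]
  exact (Module.length_eq_of_surjective (R := ResidueField R) residue_surjective).symm

/-- A regular sequence modulo which the socle is nonzero determines the depth. -/
theorem depth_eq_length [Nontrivial M] (rs : List R) (hrs : ∀ r ∈ rs, r ∈ maximalIdeal R)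
    (hreg : IsWeaklyRegular M rs)
    (hsoc : Nontrivial (Submodule.torsionBySet R
      (M ⧸ (Ideal.ofList rs • ⊤ : Submodule R M)) (maximalIdeal R : Set R))) :
    depth R M = rs.length := by
  have hlt : Ideal.ofList rs • (⊤ : Submodule R M) < ⊤ :=
    (Submodule.smul_mono_left (Ideal.span_le.2 hrs)).trans_lt maximalIdeal_smul_top_lt
  have hreg' : IsRegular M rs := ⟨hreg, hlt.ne'⟩
  refine le_antisymm (le_of_not_gt fun hgt => ?_)
    (le_iSup₂_of_le (f := fun (rs : List R) (_ : (∀ r ∈ rs, r ∈ maximalIdeal R) ∧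
      IsRegular M rs) => (rs.length : ℕ∞)) rs ⟨hrs, hreg'⟩ le_rfl)
  -- A larger depth would kill `Ext^d(k, M)` for `d = rs.length`, but this group is isomorphic to
  -- the nonzero socle.
  have hvan : ExtVanishing (maximalIdeal R) M (rs.length + 1) :=
    extVanishing_of_le_depth (by simpa using Order.add_one_le_of_lt hgt)
  obtain ⟨e⟩ := nonempty_ext_equiv_hom rs hrs (subsingleton_ext_of_isRegular hrs hreg') hreg
  obtain ⟨e'⟩ := nonempty_residueField_hom_equiv_torsionBySet (R := R)
    (M := M ⧸ (Ideal.ofList rs • ⊤ : Submodule R M))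
  have := hvan (ResidueField R) (annihilator_residueField.ge.trans Ideal.le_radical) rs.length
    (by omega)
  exact not_subsingleton _ (e ≪≫ₗ e').symm.toEquiv.subsingleton

end Noetherian

/-! ### Socles and lengths. -/

section Socle

/-- If the socle were zero, an element killed by `m^(k+1)` would be killed by `m^k`; descending to
`m^0` makes every element zero. -/
theorem nontrivial_torsionBySet_maximalIdeal {R N : Type*} [CommRing R] [IsLocalRing R]
    [AddCommGroup N] [Module R N] [Nontrivial N] {k : ℕ}
    (hk : maximalIdeal R ^ k ≤ Module.annihilator R N) :
    Nontrivial (Submodule.torsionBySet R N (maximalIdeal R : Set R)) := by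
  rw [Submodule.nontrivial_iff_ne_bot]
  intro hbot
  have key (k : ℕ) (n : N) (hn : ∀ a ∈ maximalIdeal R ^ k, a • n = 0) : n = 0 := by
    induction k with
    | zero => simpa using hn 1 (by simp)
    | succ k ih =>
      refine ih fun a ha => ?_
      rw [← Submodule.mem_bot R, ← hbot, Submodule.mem_torsionBySet_iff]
      rintro ⟨b, hb⟩
      exact (smul_smul b a n).trans (hn _ (pow_succ' (maximalIdeal R) k ▸ Ideal.mul_mem_mul hb ha))
  obtain ⟨n, hn⟩ := exists_ne (0 : N)
  exact hn (key k n fun a ha => Module.mem_annihilator.1 (hk ha) n)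

/-- Both rings act on `T` through the residue field of `A`, onto which both surject. -/
theorem length_eq_of_surjective_residueField {R A T : Type*} [CommRing R] [CommRing A]
    [IsLocalRing A] [Algebra R A] [AddCommGroup T] [Module R T] [Module A T]
    (hsmul : ∀ (r : R) (t : T), algebraMap R A r • t = r • t)
    (hsurj : Function.Surjective (algebraMap R (ResidueField A)))
    (hT : Module.IsTorsionBySet A T (maximalIdeal A : Set A)) :
    Module.length A T = Module.length R T := by
  let _ : Module (ResidueField A) T := hT.module
  have _ : IsScalarTower A (ResidueField A) T := hT.isScalarTower
  have _ : IsScalarTower R (ResidueField A) T := .of_algebraMap_smul fun r t => by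
    rw [IsScalarTower.algebraMap_apply R A (ResidueField A), ResidueField.algebraMap_eq]
    exact hsmul r t
  rw [Module.length_eq_of_surjective (R := ResidueField A) (S := A) residue_surjective,
    Module.length_eq_of_surjective (R := ResidueField A) (S := R) hsurj]

theorem length_prod_submodule {R M N : Type*} [CommRing R] [AddCommGroup M] [Module R M]
    [AddCommGroup N] [Module R N] (p : Submodule R M) (q : Submodule R N) :
    Module.length R (p.prod q) = Module.length R p + Module.length R q := by
  rw [← Module.length_prod]
  exact LinearEquiv.length_eq
    { toFun := fun x => (⟨x.1.1, x.2.1⟩, ⟨x.1.2, x.2.2⟩)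
      invFun := fun x => ⟨(x.1, x.2), x.1.2, x.2.2⟩
      map_add' := fun _ _ => rfl
      map_smul' := fun _ _ => rfl
      left_inv := fun _ => rfl
      right_inv := fun _ => rfl }

end Socle

/-! ### The socle of the idealization modulo an extended ideal. -/

section Idealization

variable {R : Type u} [CommRing R] {M : Type u} [AddCommGroup M] [Module R M]
  [Module Rᵐᵒᵖ M] [IsCentralScalar R M]

open TrivSqZeroExt

theorem mem_maximalIdeal_trivSqZeroExt [IsLocalRing R] {a : TrivSqZeroExt R M} :
    a ∈ maximalIdeal (TrivSqZeroExt R M) ↔ a.fst ∈ maximalIdeal R := by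
  simp only [mem_maximalIdeal, mem_nonunits_iff, isUnit_iff_isUnit_fst]

theorem surjective_algebraMap_residueField_trivSqZeroExt [IsLocalRing R] :
    Function.Surjective (algebraMap R (ResidueField (TrivSqZeroExt R M))) := by
  intro a
  obtain ⟨a, rfl⟩ := residue_surjective a
  refine ⟨a.fst, ?_⟩
  rw [IsScalarTower.algebraMap_apply R (TrivSqZeroExt R M), ResidueField.algebraMap_eq,
    ← sub_eq_zero, ← map_sub, residue_eq_zero_iff, mem_maximalIdeal_trivSqZeroExt]
  simp [algebraMap_eq_inl]

theorem mem_map_algebraMap_trivSqZeroExt {Q : Ideal R} {a : TrivSqZeroExt R M} :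
    a ∈ Q.map (algebraMap R (TrivSqZeroExt R M)) ↔
      a.fst ∈ Q ∧ a.snd ∈ (Q • ⊤ : Submodule R M) := by
  refine ⟨fun ha => ?_, fun ⟨h₁, h₂⟩ => ?_⟩
  · refine Submodule.span_induction ?_ ?_ ?_ ?_ ha
    · rintro _ ⟨q, hq, rfl⟩
      simpa [algebraMap_eq_inl] using hq
    · simp
    · intro x y _ _ hx hy
      exact ⟨Q.add_mem hx.1 hy.1, add_mem hx.2 hy.2⟩
    · intro b x _ hx
      refine ⟨Q.mul_mem_left _ hx.1, ?_⟩
      rw [smul_eq_mul, snd_mul]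
      refine add_mem (Submodule.smul_mem _ _ hx.2) ?_
      rw [op_smul_eq_smul]
      exact Submodule.smul_mem_smul hx.1 trivial
  · rw [← inl_fst_add_inr_snd_eq a]
    refine add_mem (Ideal.mem_map_of_mem (algebraMap R (TrivSqZeroExt R M)) h₁) ?_
    refine Submodule.smul_induction_on h₂ (fun q hq x _ => ?_) fun x y hx hy => ?_
    · have : (inr (q • x) : TrivSqZeroExt R M) = inr x * algebraMap R (TrivSqZeroExt R M) q := by
        rw [algebraMap_eq_inl, inr_mul_inl, op_smul_eq_smul]
      rw [this]
      exact Ideal.mul_mem_left _ _ (Ideal.mem_map_of_mem _ hq)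
    · rw [inr_add]
      exact add_mem hx hy

theorem maximalIdeal_le_radical_map_trivSqZeroExt [IsLocalRing R] {Q : Ideal R}
    (hQ : maximalIdeal R ≤ Q.radical) :
    maximalIdeal (TrivSqZeroExt R M) ≤ (Q.map (algebraMap R (TrivSqZeroExt R M))).radical := by
  intro a ha
  obtain ⟨k, hk⟩ := hQ (mem_maximalIdeal_trivSqZeroExt.1 ha)
  rw [← inl_fst_add_inr_snd_eq a]
  refine add_mem ⟨k, ?_⟩ ⟨2, ?_⟩
  · rw [inl_pow]
    exact Ideal.mem_map_of_mem (algebraMap R (TrivSqZeroExt R M)) hk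
  · rw [pow_two, inr_mul_inr]
    exact zero_mem _

/-- The reduction of the idealization modulo an extended ideal, as an `R`-module. -/
noncomputable def quotientTrivSqZeroExtEquiv (Q : Ideal R) :
    (TrivSqZeroExt R M ⧸ (Q.map (algebraMap R (TrivSqZeroExt R M)))) ≃ₗ[R]
      (R ⧸ Q) × (M ⧸ (Q • ⊤ : Submodule R M)) :=
  letI f : TrivSqZeroExt R M →ₗ[R] (R ⧸ Q) × (M ⧸ (Q • ⊤ : Submodule R M)) :=
    (Submodule.mkQ Q ∘ₗ (fstHom R R M).toLinearMap).prod
      (Submodule.mkQ (Q • ⊤ : Submodule R M) ∘ₗ sndHom R M)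
  haveI hf : Function.Surjective f := fun ⟨x, y⟩ => by
    obtain ⟨x, rfl⟩ := Submodule.mkQ_surjective _ x
    obtain ⟨y, rfl⟩ := Submodule.mkQ_surjective _ y
    exact ⟨(x, y), rfl⟩
  haveI hker : (Q.map (algebraMap R (TrivSqZeroExt R M))).restrictScalars R = LinearMap.ker f := by
    ext a
    simp [f, mem_map_algebraMap_trivSqZeroExt, Submodule.Quotient.mk_eq_zero,
      Ideal.Quotient.eq_zero_iff_mem]
  (Submodule.Quotient.restrictScalarsEquiv R _).symm ≪≫ₗ Submodule.quotEquivOfEq _ _ hker ≪≫ₗ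
    f.quotKerEquivOfSurjective hf

theorem quotientTrivSqZeroExtEquiv_mk (Q : Ideal R) (a : TrivSqZeroExt R M) :
    quotientTrivSqZeroExtEquiv Q (Submodule.Quotient.mk a) =
      (Submodule.Quotient.mk a.fst, Submodule.Quotient.mk a.snd) :=
  rfl

variable [IsLocalRing R]

variable (M) in
/-- The part of the socle of `R / Q` that annihilates `M / Q M`. -/
def annihilatingSocle (Q : Ideal R) : Submodule R (R ⧸ Q) :=
  Submodule.torsionBySet R (R ⧸ Q) (maximalIdeal R : Set R) ⊓
    Submodule.map (Submodule.mkQ Q)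
      (Module.annihilator R (M ⧸ (Q • ⊤ : Submodule R M)))

omit [Module Rᵐᵒᵖ M] [IsCentralScalar R M] [IsLocalRing R] in
theorem le_annihilator_quotient_smul_top (Q : Ideal R) :
    Q ≤ Module.annihilator R (M ⧸ (Q • ⊤ : Submodule R M)) := fun q hq =>
  Module.mem_annihilator.2 fun x => by
    obtain ⟨x, rfl⟩ := Submodule.mkQ_surjective _ x
    rw [← map_smul]
    exact (Submodule.Quotient.mk_eq_zero _).2 (Submodule.smul_mem_smul hq trivial)

omit [Module Rᵐᵒᵖ M] [IsCentralScalar R M] [IsLocalRing R] in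
theorem mk_mem_map_annihilator_iff {Q : Ideal R} {r : R} :
    (Submodule.Quotient.mk r : R ⧸ Q) ∈
        Submodule.map (Submodule.mkQ Q)
      (Module.annihilator R (M ⧸ (Q • ⊤ : Submodule R M))) ↔
      ∀ x : M, r • x ∈ (Q • ⊤ : Submodule R M) := by
  change r ∈ Submodule.comap (Submodule.mkQ Q) (Submodule.map (Submodule.mkQ Q) _) ↔ _
  rw [Submodule.comap_map_mkQ, sup_eq_right.2 (le_annihilator_quotient_smul_top Q),
    Module.mem_annihilator, (Submodule.mkQ_surjective _).forall]
  refine forall_congr' fun x => ?_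
  rw [← map_smul]
  exact Submodule.Quotient.mk_eq_zero _

/-- The maximal ideal of `R ⋉ M` consists of sums `(b, 0) + (0, y)` with `b` in `m`. Elements `(b,
0)` force both coordinates into the socles; elements `(0, y)` force the first coordinate to kill
`M/QM`. -/
theorem map_socle_quotientTrivSqZeroExt {Q : Ideal R} :
    ((Submodule.torsionBySet (TrivSqZeroExt R M)
        (TrivSqZeroExt R M ⧸ (Q.map (algebraMap R (TrivSqZeroExt R M))))
        (maximalIdeal (TrivSqZeroExt R M) : Set (TrivSqZeroExt R M))).restrictScalars R).map
        (quotientTrivSqZeroExtEquiv Q).toLinearMap =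
      (annihilatingSocle M Q).prod (Submodule.torsionBySet R (M ⧸ (Q • ⊤ : Submodule R M))
        (maximalIdeal R : Set R)) := by
  have hmem (N : Type u) [AddCommGroup N] [Module R N] (p : Submodule R N) (x : N) :
      (Submodule.Quotient.mk x : N ⧸ p) ∈
        Submodule.torsionBySet R (N ⧸ p) (maximalIdeal R : Set R) ↔
      ∀ b ∈ maximalIdeal R, b • x ∈ p := by
    simp [Submodule.mem_torsionBySet_iff, ← Submodule.Quotient.mk_smul,
      Submodule.Quotient.mk_eq_zero]
  ext t
  rw [Submodule.mem_map_equiv]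
  obtain ⟨t, rfl⟩ := (quotientTrivSqZeroExtEquiv Q).surjective t
  obtain ⟨a, rfl⟩ := Submodule.Quotient.mk_surjective _ t
  rw [LinearEquiv.symm_apply_apply, quotientTrivSqZeroExtEquiv_mk, Submodule.mem_prod,
    annihilatingSocle, Submodule.mem_inf, mk_mem_map_annihilator_iff, hmem, hmem,
    Submodule.restrictScalars_mem, Submodule.mem_torsionBySet_iff]
  have hsmul (b : TrivSqZeroExt R M) :
      b • (Submodule.Quotient.mk a :
        TrivSqZeroExt R M ⧸ (Q.map (algebraMap R (TrivSqZeroExt R M)))) = 0 ↔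
      b.fst * a.fst ∈ Q ∧ b.fst • a.snd + a.fst • b.snd ∈ (Q • ⊤ : Submodule R M) := by
    rw [← Submodule.Quotient.mk_smul, Submodule.Quotient.mk_eq_zero,
      mem_map_algebraMap_trivSqZeroExt, smul_eq_mul, fst_mul, snd_mul, op_smul_eq_smul]
  refine ⟨fun h => ?_, fun ⟨⟨h₁, h₂⟩, h₃⟩ b => ?_⟩
  · have h (b : R) (y : M) (hb : b ∈ maximalIdeal R) := (hsmul (inl b + inr y)).1
      (h ⟨inl b + inr y, mem_maximalIdeal_trivSqZeroExt.2 (by simpa using hb)⟩)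
    simp only [fst_add, fst_inl, fst_inr, add_zero, snd_add, snd_inl, snd_inr, zero_add] at h
    refine ⟨⟨fun b hb => (h b 0 hb).1, fun y => ?_⟩, fun b hb => ?_⟩
    · simpa using (h 0 y (zero_mem _)).2
    · simpa using (h b 0 hb).2
  · refine (hsmul b).2 ⟨h₁ _ (mem_maximalIdeal_trivSqZeroExt.1 b.2), add_mem ?_ (h₂ _)⟩
    exact h₃ _ (mem_maximalIdeal_trivSqZeroExt.1 b.2)

theorem length_socle_quotientTrivSqZeroExt (Q : Ideal R) :
    Module.length (TrivSqZeroExt R M) (Submodule.torsionBySet (TrivSqZeroExt R M)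
        (TrivSqZeroExt R M ⧸ (Q.map (algebraMap R (TrivSqZeroExt R M))))
        (maximalIdeal (TrivSqZeroExt R M) : Set (TrivSqZeroExt R M))) =
      Module.length R (annihilatingSocle M Q) +
        Module.length R (Submodule.torsionBySet R (M ⧸ (Q • ⊤ : Submodule R M))
          (maximalIdeal R : Set R)) := by
  set T := Submodule.torsionBySet (TrivSqZeroExt R M)
    (TrivSqZeroExt R M ⧸ (Q.map (algebraMap R (TrivSqZeroExt R M))))
    (maximalIdeal (TrivSqZeroExt R M) : Set (TrivSqZeroExt R M))
  rw [← length_prod_submodule, ← map_socle_quotientTrivSqZeroExt,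
    ← ((quotientTrivSqZeroExtEquiv (M := M) Q).submoduleMap (T.restrictScalars R)).length_eq]
  exact length_eq_of_surjective_residueField (T := T.restrictScalars R)
    (fun r t => Subtype.ext (algebraMap_smul (TrivSqZeroExt R M) r (t : TrivSqZeroExt R M ⧸
      (Q.map (algebraMap R (TrivSqZeroExt R M))))))
    (surjective_algebraMap_residueField_trivSqZeroExt (M := M))
    (Submodule.torsionBySet_isTorsionBySet _)

end Idealization

/-! ### Parameter ideals. -/

section ParameterIdeal

variable {R : Type u} [CommRing R] [IsLocalRing R]

/-- Needed for the two inequalities, which mention no `Q`. -/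
theorem exists_isParameterIdeal (R : Type u) [CommRing R] [IsLocalRing R] [IsNoetherianRing R] :
    ∃ Q : Ideal R, IsParameterIdeal Q := by
  obtain ⟨J, hJ, hrank, hheight⟩ :=
    Ideal.exists_spanRank_eq_and_height_eq (maximalIdeal R) Ideal.IsPrime.ne_top'
  have hfg : Submodule.FG J := IsNoetherian.noetherian J
  obtain ⟨s, hcard, hspan⟩ := Submodule.FG.exists_span_finset_card_eq_spanFinrank hfg
  have hdim : (s.card : WithBot ℕ∞) = ringKrullDim R := by
    rw [← maximalIdeal_height_eq_ringKrullDim, hcard]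
    rw [hfg.spanRank_eq_spanFinrank] at hrank
    have : ((J.spanFinrank : ℕ∞) : Cardinal.{u}) = (maximalIdeal R).height := by simpa using hrank
    rw [← Cardinal.ofENat_injective this]
    rfl
  refine ⟨J, s.card, fun i => s.equivFin.symm i, hdim, ?_, ?_⟩
  · rw [← hspan]
    congr 1
    ext x
    simp only [Set.mem_range]
    exact ⟨fun hx => ⟨s.equivFin ⟨x, hx⟩, by simp⟩, fun ⟨i, hi⟩ => hi ▸ (s.equivFin.symm i).2⟩
  · refine le_antisymm ((maximalIdeal.isMaximal R).isPrime.isRadical.radical_le_iff.2 hJ) ?_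
    rw [Ideal.radical_eq_sInf]
    refine le_sInf fun p ⟨hp, hp'⟩ => ?_
    -- A prime over `J` has at least the height of `J`, which is `dim R`; hence it is the maximal
    -- ideal.
    have : (p.height : WithBot ℕ∞) = ringKrullDim R := by
      refine le_antisymm (Ideal.height_le_ringKrullDim_of_ne_top hp'.ne_top) ?_
      rw [← maximalIdeal_height_eq_ringKrullDim, ← hheight]
      exact_mod_cast Ideal.height_mono hp
    exact (eq_maximalIdeal ((Ideal.height_eq_ringKrullDim_iff.1 this) ▸ inferInstance)).ge

theorem IsParameterIdeal.exists_list {Q : Ideal R} (hQ : IsParameterIdeal Q) :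
    ∃ rs : List R, (rs.length : WithBot ℕ∞) = ringKrullDim R ∧ Q = Ideal.ofList rs ∧
      (∀ r ∈ rs, r ∈ maximalIdeal R) ∧ maximalIdeal R ≤ Q.radical := by
  obtain ⟨d, x, hd, hx, hrad⟩ := hQ
  refine ⟨List.ofFn x, by simpa using hd, ?_, fun r hr => ?_, hrad.ge⟩
  · rw [hx, Ideal.ofList]
    congr 1
    ext r
    simp [List.mem_ofFn]
  · rw [← hrad, hx]
    refine Ideal.le_radical (Ideal.subset_span ?_)
    simpa [List.mem_ofFn] using hr

theorem exists_pow_le_of_le_radical [IsNoetherianRing R] {I : Ideal R}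
    (hI : maximalIdeal R ≤ I.radical) : ∃ k, maximalIdeal R ^ k ≤ I := by
  obtain ⟨k, hk⟩ := I.exists_radical_pow_le_of_fg (IsNoetherian.noetherian _)
  exact ⟨k, (Ideal.pow_right_mono hI k).trans hk⟩

end ParameterIdeal

/-! ### The type of the idealization and its extreme values. -/

section CMTypeFormula

variable {R : Type u} [CommRing R] [IsLocalRing R] [IsNoetherianRing R]

theorem cmType_self_eq_length (rs : List R) (hrs : ∀ r ∈ rs, r ∈ maximalIdeal R)
    (h : ExtVanishing (maximalIdeal R) R rs.length) (hreg : IsWeaklyRegular R rs)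
    (hdepth : depth R R = rs.length) :
    (cmType R R : ℕ∞) = Module.length R (Submodule.torsionBySet R (R ⧸ Ideal.ofList rs)
      (maximalIdeal R : Set R)) := by
  have key (I J : Ideal R) (hIJ : I = J) :
      Module.length R (Submodule.torsionBySet R (HasQuotient.Quotient (A := R) (B := Submodule R R) I)
        (maximalIdeal R : Set R)) =
      Module.length R (Submodule.torsionBySet R (R ⧸ J) (maximalIdeal R : Set R)) := by
    subst hIJ
    rfl
  rw [cmType_eq_length rs hrs h hreg hdepth]
  exact key _ _ (by rw [smul_eq_mul, Ideal.mul_top])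

variable {M : Type u} [AddCommGroup M] [Module R M] [Module.Finite R M]

-- The exact sequence `0 → M → R ⋉ M → R → 0` carries the vanishing to its middle term, which makes
-- parameters of `R` regular on `R ⋉ M`.
omit [IsLocalRing R] [IsNoetherianRing R] [Module.Finite R M] in
theorem ExtVanishing.trivSqZeroExt {I : Ideal R} {d : ℕ} (hR : ExtVanishing I R d)
    (hM : ExtVanishing I M d) : ExtVanishing I (TrivSqZeroExt R M) d := by
  refine .of_exact (TrivSqZeroExt.inrHom R M) (LinearMap.fst R R M : TrivSqZeroExt R M →ₗ[R] R)
    TrivSqZeroExt.inr_injective TrivSqZeroExt.fst_surjective ?_ hM hR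
  intro a
  refine ⟨fun h => ⟨a.snd, TrivSqZeroExt.ext h.symm rfl⟩, ?_⟩
  rintro ⟨x, rfl⟩
  rfl

/-- The type of the idealization, in terms of a sequence of parameters. -/
theorem cmType_trivSqZeroExt [Nontrivial M] [Module Rᵐᵒᵖ M] [IsCentralScalar R M]
    (rs : List R) (hrs : ∀ r ∈ rs, r ∈ maximalIdeal R)
    (hR : ExtVanishing (maximalIdeal R) R rs.length)
    (hM : ExtVanishing (maximalIdeal R) M rs.length)
    (hrad : maximalIdeal R ≤ (Ideal.ofList rs).radical) (hdepth : depth R M = rs.length) :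
    (cmType (TrivSqZeroExt R M) (TrivSqZeroExt R M) : ℕ∞) =
      Module.length R (annihilatingSocle M (Ideal.ofList rs)) + cmType R M := by
  have : Module.Finite R (TrivSqZeroExt R M) := inferInstanceAs (Module.Finite R (R × M))
  have : IsNoetherianRing (TrivSqZeroExt R M) := .of_finite R _
  set rsA := rs.map (algebraMap R (TrivSqZeroExt R M)) with hrsA
  have hmem : ∀ r ∈ rsA, r ∈ maximalIdeal (TrivSqZeroExt R M) := by
    simpa [hrsA, mem_maximalIdeal_trivSqZeroExt, TrivSqZeroExt.algebraMap_eq_inl] using hrs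
  have hmap : (Ideal.ofList rs).map (algebraMap R (TrivSqZeroExt R M)) = Ideal.ofList rsA :=
    Ideal.map_ofList _ _
  have hreg : IsWeaklyRegular (TrivSqZeroExt R M) rsA := by
    rw [hrsA, isWeaklyRegular_map_algebraMap_iff]
    exact (hR.trivSqZeroExt hM).isWeaklyRegular rs hrs
      (hrad.trans (Ideal.radical_mono le_sup_left))
  have hne : Ideal.ofList rsA ≠ ⊤ := fun h =>
    Ideal.IsPrime.ne_top' (top_le_iff.1 (h.ge.trans (Ideal.span_le.2 hmem)))
  have hsoc : Nontrivial (Submodule.torsionBySet (TrivSqZeroExt R M)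
      (TrivSqZeroExt R M ⧸ (Ideal.ofList rsA • ⊤ : Submodule (TrivSqZeroExt R M) (TrivSqZeroExt R M)))
      (maximalIdeal (TrivSqZeroExt R M) : Set (TrivSqZeroExt R M))) := by
    obtain ⟨k, hk⟩ := exists_pow_le_of_le_radical (hmap ▸
      maximalIdeal_le_radical_map_trivSqZeroExt (M := M) hrad)
    have : Nontrivial (TrivSqZeroExt R M ⧸
        (Ideal.ofList rsA • ⊤ : Submodule (TrivSqZeroExt R M) (TrivSqZeroExt R M))) := by
      rwa [Submodule.Quotient.nontrivial_iff, smul_eq_mul, Ideal.mul_top]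
    exact nontrivial_torsionBySet_maximalIdeal (hk.trans (le_annihilator_quotient_smul_top _))
  -- The depth of `R ⋉ M` comes from the nonzero socle, with no computation of its dimension.
  have hdepthA : depth (TrivSqZeroExt R M) (TrivSqZeroExt R M) = rsA.length :=
    depth_eq_length rsA hmem hreg hsoc
  rw [cmType_self_eq_length rsA hmem (extVanishing_of_le_depth hdepthA.ge) hreg hdepthA, ← hmap,
    length_socle_quotientTrivSqZeroExt, cmType_eq_length rs hrs hM
      (hM.isWeaklyRegular rs hrs (hrad.trans (Ideal.radical_mono le_sup_left))) hdepth]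

omit [IsNoetherianRing R] [Module.Finite R M] in
theorem annihilatingSocle_le (Q : Ideal R) : annihilatingSocle M Q ≤
    Submodule.torsionBySet R (R ⧸ Q) (maximalIdeal R : Set R) :=
  inf_le_left

-- A power of `m` lies in `Q`, so every nonzero ideal of `R/Q` meets the socle; apply this to the
-- annihilator of `M/QM`.
omit [Module.Finite R M] in
theorem annihilatingSocle_eq_bot_iff {Q : Ideal R} (hQ : maximalIdeal R ≤ Q.radical) :
    annihilatingSocle M Q = ⊥ ↔ FaithfulSMul (R ⧸ Q) (M ⧸ (Q • ⊤ : Submodule R M)) := by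
  have hfaithful : FaithfulSMul (R ⧸ Q) (M ⧸ (Q • ⊤ : Submodule R M)) ↔
      Submodule.map (Submodule.mkQ Q) (Module.annihilator R (M ⧸ (Q • ⊤ : Submodule R M))) = ⊥ := by
    rw [← Module.annihilator_eq_bot, eq_bot_iff, eq_bot_iff]
    refine forall_congr' fun r => ?_
    obtain ⟨r, rfl⟩ := Submodule.mkQ_surjective _ r
    refine imp_congr ?_ Iff.rfl
    refine Iff.trans ?_ mk_mem_map_annihilator_iff.symm
    rw [Module.mem_annihilator, (Submodule.mkQ_surjective _).forall]
    exact forall_congr' fun x => Submodule.Quotient.mk_eq_zero _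
  rw [hfaithful]
  refine ⟨fun h => ?_, fun h => by rw [annihilatingSocle, h, inf_bot_eq]⟩
  by_contra hne
  set N := Submodule.map (Submodule.mkQ Q)
    (Module.annihilator R (M ⧸ (Q • ⊤ : Submodule R M)))
  have : Nontrivial N := (Submodule.nontrivial_iff_ne_bot).2 hne
  obtain ⟨k, hk⟩ := exists_pow_le_of_le_radical hQ
  have hann : Q ≤ Module.annihilator R N :=
    Ideal.annihilator_quotient.ge.trans
      (LinearMap.annihilator_le_of_injective N.subtype N.subtype_injective)
  have := nontrivial_torsionBySet_maximalIdeal (hk.trans hann)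
  obtain ⟨⟨n, hn⟩, hn0⟩ := exists_ne (0 : Submodule.torsionBySet R N (maximalIdeal R : Set R))
  refine hn0 (Subtype.ext (Subtype.ext ((Submodule.mem_bot R).1 (h ▸ ⟨?_, n.2⟩))))
  rw [SetLike.mem_coe, Submodule.mem_torsionBySet_iff]
  exact fun a => congrArg Subtype.val ((Submodule.mem_torsionBySet_iff _ _).1 hn a)

-- The socle of `R/Q` is `(Q : m)/Q`, so it kills `M/QM` exactly when `(Q : m)M ⊆ QM`; the other
-- inclusion is automatic.
omit [IsNoetherianRing R] [Module.Finite R M] in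
theorem annihilatingSocle_eq_iff {Q : Ideal R} :
    annihilatingSocle M Q = Submodule.torsionBySet R (R ⧸ Q) (maximalIdeal R : Set R) ↔
      Q.colon (maximalIdeal R : Set R) • (⊤ : Submodule R M) = Q • (⊤ : Submodule R M) := by
  have hle : Q • (⊤ : Submodule R M) ≤ Q.colon (maximalIdeal R : Set R) • (⊤ : Submodule R M) :=
    Submodule.smul_mono_left fun q hq => Submodule.mem_colon.2 fun a _ => Q.mul_mem_right a hq
  rw [annihilatingSocle, inf_eq_left, ← hle.ge_iff_eq', Submodule.smul_le]
  refine ⟨fun h r hr x _ => ?_, fun h r hr => ?_⟩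
  · refine mk_mem_map_annihilator_iff.1 (h (x := Submodule.Quotient.mk r) ?_) x
    rw [Submodule.mem_torsionBySet_iff]
    rintro ⟨a, ha⟩
    refine (Submodule.Quotient.mk_eq_zero (p := Q) (x := a • r)).2 ?_
    rw [smul_eq_mul, mul_comm]
    exact Submodule.mem_colon.1 hr a ha
  · obtain ⟨r, rfl⟩ := Submodule.mkQ_surjective _ r
    refine mk_mem_map_annihilator_iff.2 fun x => h r (Submodule.mem_colon.2 fun a ha => ?_) x trivial
    rw [smul_eq_mul, mul_comm]
    exact (Submodule.Quotient.mk_eq_zero (p := Q) (x := a • r)).1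
      ((Submodule.mem_torsionBySet_iff _ _).1 hr ⟨a, ha⟩)

end CMTypeFormula

end LocalAlgebra

theorem corollary2p3 {R : Type u} [CommRing R] [IsLocalRing R] [IsNoetherianRing R]
    (hR : LocalAlgebra.IsCohenMacaulayRing R)
    {M : Type u} [AddCommGroup M] [Module R M] [Module Rᵐᵒᵖ M] [IsCentralScalar R M]
    [Module.Finite R M] (hM : LocalAlgebra.IsMaximalCohenMacaulay R M) :
    (LocalAlgebra.cmType R M ≤
        LocalAlgebra.cmType (TrivSqZeroExt R M) (TrivSqZeroExt R M) ∧
      LocalAlgebra.cmType (TrivSqZeroExt R M) (TrivSqZeroExt R M) ≤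
        LocalAlgebra.cmType R R + LocalAlgebra.cmType R M) ∧
    ∀ Q : Ideal R, LocalAlgebra.IsParameterIdeal Q →
      (LocalAlgebra.cmType (TrivSqZeroExt R M) (TrivSqZeroExt R M) = LocalAlgebra.cmType R M ↔
        FaithfulSMul (R ⧸ Q) (M ⧸ (Q • ⊤ : Submodule R M))) ∧
      (LocalAlgebra.cmType (TrivSqZeroExt R M) (TrivSqZeroExt R M) =
          LocalAlgebra.cmType R R + LocalAlgebra.cmType R M ↔
        Q.colon (maximalIdeal R : Set R) • (⊤ : Submodule R M) = Q • (⊤ : Submodule R M)) := by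
  open LocalAlgebra in
  have := hM.nontrivial
  -- Here `s` is the length of `annihilatingSocle M Q`, a natural number because the socle of `R/Q`
  -- has length `r(R)`.
  have key (Q : Ideal R) (hQ : IsParameterIdeal Q) : ∃ s : ℕ, s ≤ cmType R R ∧
      cmType (TrivSqZeroExt R M) (TrivSqZeroExt R M) = s + cmType R M ∧
      (s = 0 ↔ FaithfulSMul (R ⧸ Q) (M ⧸ (Q • ⊤ : Submodule R M))) ∧
      (s = cmType R R ↔ Q.colon (maximalIdeal R : Set R) • (⊤ : Submodule R M) =
        Q • (⊤ : Submodule R M)) := by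
    obtain ⟨rs, hdim, rfl, hrs, hrad⟩ := hQ.exists_list
    have hdR : depth R R = rs.length := WithBot.coe_injective (hR.trans hdim.symm)
    have hdM : depth R M = rs.length := WithBot.coe_injective (hM.depth_eq.trans hdim.symm)
    have hvR := extVanishing_of_le_depth hdR.ge
    have hvM := extVanishing_of_le_depth hdM.ge
    have hA := cmType_trivSqZeroExt rs hrs hvR hvM hrad hdM
    have hRR := cmType_self_eq_length rs hrs hvR
      (hvR.isWeaklyRegular rs hrs (hrad.trans (Ideal.radical_mono le_sup_left))) hdR
    set S := annihilatingSocle M (Ideal.ofList rs)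
    set T := Submodule.torsionBySet R (R ⧸ Ideal.ofList rs) (maximalIdeal R : Set R)
    have hST : S ≤ T := annihilatingSocle_le _
    have hT : Module.length R T ≠ ⊤ := hRR ▸ ENat.natCast_ne_top _
    have hle : Module.length R S ≤ Module.length R T :=
      Module.length_le_of_injective _ (Submodule.inclusion_injective hST)
    obtain ⟨s, hs⟩ := ENat.ne_top_iff_exists.1 (ne_top_of_le_ne_top hT hle)
    rw [← hs] at hA
    refine ⟨s, by exact_mod_cast hs ▸ hRR ▸ hle, by exact_mod_cast hA, ?_, ?_⟩
    · rw [← annihilatingSocle_eq_bot_iff hrad, ← Nat.cast_eq_zero (R := ℕ∞), hs,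
        Module.length_eq_zero_iff, Submodule.subsingleton_iff_eq_bot]
    · rw [← annihilatingSocle_eq_iff, ← Nat.cast_inj (R := ℕ∞), hs, hRR]
      refine ⟨fun h => ?_, fun h => congrArg (fun N : Submodule R _ => Module.length R N) h⟩
      rw [Module.length_submodule, Module.length_submodule] at h
      -- A proper submodule of a module of finite length has strictly smaller length.
      by_contra hne
      refine (Order.height_strictMono (lt_of_le_of_ne hST hne) ?_).ne h
      rw [← Module.length_submodule]
      exact (ne_top_of_le_ne_top hT hle).lt_top
  refine ⟨?_, fun Q hQ => ?_⟩
  · obtain ⟨Q, hQ⟩ := exists_isParameterIdeal R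
    obtain ⟨s, hs, hA, -⟩ := key Q hQ
    omega
  · obtain ⟨s, hs, hA, h₁, h₂⟩ := key Q hQ
    rw [← h₁, ← h₂]
    omega
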